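/- For a finite simple graph $F$ let $\mathrm{rex}(n,F)$ denote the maximum number of edges in a regular graph on $n$ vertices that does not contain $F$ as a (not necessarily induced) subgraph, and let the odd girth of $F$ be the length of a shortest odd cycle in $F$. (1) If $\chi(F)=3$ and $F$ has odd girth $g$, then $\mathrm{rex}(n,F)\ge \frac{n^2}{g+2}-O(n)$ for every odd $n$; that is, there is a constant $C$ depending only on $F$ such that $\mathrm{rex}(n,F)\ge \frac{n^2}{g+2}-Cn$ for every odd $n$. Now let $F=C_5$, or let $F$ be a unicyclic graph with $C_5$ as its cycle (that is, $F$ contains exactly one cycle, and this cycle has length $5$; $F$ need not be connected). (2) Then $\mathrm{rex}(n,F)=\frac{n^2}{7}-O(n)$ for odd $n$; that is, there is a constant $C$ depending only on $F$ such that $\mathrm{rex}(n,F)\ge \frac{n^2}{7}-Cn$ for every odd $n$, and $\mathrm{rex}(n,F)\le \frac{n^2}{7}$ for every odd $n$ that is sufficiently large with respect to $F$. (3) More precisely, $\mathrm{rex}(n,F)=n\cdot\lfloor n/7\rfloor$ for every odd $n$ that is sufficiently large with respect to $F$. -/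

import Mathlib

/-- The *regular Turán number* `rex(n, F)`: the maximum number of edges in a regular graph on `n`
vertices that does not contain `F` as a (not necessarily induced) subgraph. -/
noncomputable def rex (n : ℕ) {W : Type*} (F : SimpleGraph W) : ℕ :=
  open Classical in
  Finset.sup {G : SimpleGraph (Fin n) | F.Free G ∧ ∃ d : ℕ, G.IsRegularOfDegree d}
    (fun G => G.edgeFinset.card)

/-- `g` is the *odd girth* of `F`: the length of a shortest odd cycle in `F`. -/
def HasOddGirth {W : Type*} (F : SimpleGraph W) (g : ℕ) : Prop :=
  IsLeast {m : ℕ | Odd m ∧ ∃ (v : W) (c : F.Walk v v), c.IsCycle ∧ c.length = m} g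

/-- `F` is *unicyclic with cycle* `C_m`: it contains, as a subgraph, exactly one cycle, and this
cycle has length `m`. A closed walk and its rotations and reversal give the same subgraph.
Connectedness is not demanded, so this covers in particular the connected unicyclic graphs. -/
def IsUnicyclicWith {W : Type*} (F : SimpleGraph W) (m : ℕ) : Prop :=
  ∃ (v : W) (c : F.Walk v v), c.IsCycle ∧ c.length = m ∧
    ∀ (w : W) (c' : F.Walk w w), c'.IsCycle → c'.toSubgraph = c.toSubgraph

/-! Lower bounds come from regular spanning subgraphs of blow-ups of a cycle of length `k = g + 2`.
Such a graph maps homomorphically to that cycle, so it has no odd closed walk of length `g` and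
cannot contain `F`. For `n = k * q + 2 * j` with `j ≤ q`, adding `j` vertices to each of two
consecutive parts and thinning some pairs gives a `2 * q`-regular graph (`mul_le_rex_of_even`). For
`k = 7` and odd `n % 7` a finer balancing keeps `q = n / 7` (`mul_le_rex_of_odd`).

For the upper bound, a regular graph of odd order has even degree `d`, so `d > 2 * (n / 7)` forces
`7 * d > 2 * n`. If such a graph has no pentagon, edges have few common neighbours. A triangle
together with one further neighbour would then have four almost disjoint neighbourhoods, more than
`n` vertices allow. So the graph is triangle-free, and it is not bipartite since `n` is odd. By the
Andrásfai–Erdős–Sós averaging, a shortest odd closed walk of length `ℓ ≥ 5` satisfies `ℓ * d ≤ 2 *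
n`, hence `ℓ = 5`, a pentagon after all (`IsRegularOfDegree.cycleGraph_five_isContained`). For
unicyclic `F` the rest is attached greedily to the pentagon, as all degrees are at least the order
of `F` (`isContained_of_isUnicyclicWith_five`). -/

namespace SimpleGraph

/-! ### Pentagons in dense regular graphs of odd order. -/

section Pentagon

variable {V : Type*} {G : SimpleGraph V}

theorem cycleGraph_five_isContained {a b c d e : V} (hab : G.Adj a b) (hbc : G.Adj b c)
    (hcd : G.Adj c d) (hde : G.Adj d e) (hea : G.Adj e a) (hac : a ≠ c) (had : a ≠ d)
    (hbd : b ≠ d) (hbe : b ≠ e) (hce : c ≠ e) : cycleGraph 5 ⊑ G := by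
  refine ⟨⟨⟨![a, b, c, d, e], ?_⟩, ?_⟩⟩
  · intro i j h
    fin_cases i <;> fin_cases j <;> first
      | exact absurd h (by decide)
      | simp [hab, hbc, hcd, hde, hea, hab.symm, hbc.symm, hcd.symm, hde.symm, hea.symm]
  · intro i j h
    fin_cases i <;> fin_cases j <;>
      simp_all [hab.ne, hbc.ne, hcd.ne, hde.ne, hea.ne, hab.ne.symm, hbc.ne.symm, hcd.ne.symm,
        hde.ne.symm, hea.ne.symm, hac.symm, had.symm, hbd.symm, hbe.symm, hce.symm]

theorem Walk.exists_walk_getVert {u v : V} (w : G.Walk u v) {i j : ℕ} (hij : i ≤ j)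
    (hj : j ≤ w.length) : ∃ p : G.Walk (w.getVert i) (w.getVert j), p.length = j - i := by
  have h : (w.drop i).getVert (j - i) = w.getVert j := by
    rw [Walk.drop_getVert]; congr 1; omega
  refine ⟨((w.drop i).take (j - i)).copy rfl h, ?_⟩
  simp
  omega

/-- No vertex has three neighbours on a shortest closed walk of odd length at least five. -/
theorem Walk.not_three_adj_getVert {u : V} (w : G.Walk u u) (hw : Odd w.length)
    (h5 : 5 ≤ w.length)
    (hmin : ∀ (x : V) (p : G.Walk x x), Odd p.length → w.length ≤ p.length)
    {v : V} {i j k : ℕ} (hij : i < j) (hjk : j < k) (hk : k < w.length)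
    (hi : G.Adj (w.getVert i) v) (hj : G.Adj (w.getVert j) v) (hk' : G.Adj (w.getVert k) v) :
    False := by
  obtain ⟨p, hp⟩ := w.exists_walk_getVert hij.le (by omega)
  obtain ⟨q, hq⟩ := w.exists_walk_getVert hjk.le (by omega)
  -- The three arcs of `w` cut off at `i`, `j`, `k` have odd total length, and each closes up
  -- through `v` at a cost of 2. If exactly one arc is odd, the other two have length at least 2, so
  -- its closure is shorter than `w`. If all three are odd, minimality gives `3 * (w.length - 2) ≤
  -- w.length`, impossible from length 5 on.
  have h1 := hmin _ (Walk.cons hi.symm (p.concat hj))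
  have h2 := hmin _ (Walk.cons hj.symm (q.concat hk'))
  have h3 := hmin _ (Walk.cons hk'.symm (((w.drop k).append (w.take i)).concat hi))
  simp only [Walk.length_cons, Walk.length_concat, Walk.length_append, Walk.drop_length,
    Walk.take_length, hp, hq, Nat.odd_iff] at h1 h2 h3 hw
  rw [min_eq_left (by omega : i ≤ w.length)] at h3
  omega

variable [Fintype V] [DecidableEq V] [DecidableRel G.Adj] {d : ℕ}

omit [DecidableEq V] in
/-- The averaging argument of Andrásfai, Erdős and Sós. -/
theorem Walk.length_mul_le_of_shortest_odd {u : V} (w : G.Walk u u) (hw : Odd w.length)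
    (h5 : 5 ≤ w.length)
    (hmin : ∀ (x : V) (p : G.Walk x x), Odd p.length → w.length ≤ p.length)
    (hd : G.IsRegularOfDegree d) : w.length * d ≤ 2 * Fintype.card V := by
  have h := Finset.sum_card_bipartiteAbove_eq_sum_card_bipartiteBelow
    (s := Finset.range w.length) (t := (Finset.univ : Finset V))
    (fun i v => G.Adj (w.getVert i) v)
  have hl : ∀ i ∈ Finset.range w.length,
      ((Finset.univ : Finset V).bipartiteAbove (fun i v => G.Adj (w.getVert i) v) i).card = d := by
    intro i _
    rw [← hd (w.getVert i), ← card_neighborFinset_eq_degree]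
    congr 1
    ext v
    simp [Finset.bipartiteAbove]
  have hr : ∀ v ∈ (Finset.univ : Finset V),
      ((Finset.range w.length).bipartiteBelow (fun i v => G.Adj (w.getVert i) v) v).card ≤ 2 := by
    intro v _
    by_contra hlt
    obtain ⟨a, ha, b, hb, c, hc, hab, hac, hbc⟩ := Finset.two_lt_card.1 (not_le.1 hlt)
    simp only [Finset.bipartiteBelow, Finset.mem_filter, Finset.mem_range] at ha hb hc
    have key : ∀ {i j k : ℕ}, i < j → j < k → k < w.length → G.Adj (w.getVert i) v →
        G.Adj (w.getVert j) v → G.Adj (w.getVert k) v → False :=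
      fun hij hjk hk h1 h2 h3 => w.not_three_adj_getVert hw h5 hmin hij hjk hk h1 h2 h3
    rcases lt_or_gt_of_ne hab with h1 | h1 <;> rcases lt_or_gt_of_ne hac with h2 | h2 <;>
      rcases lt_or_gt_of_ne hbc with h3 | h3
    · exact key h1 h3 hc.1 ha.2 hb.2 hc.2
    · exact key h2 h3 hb.1 ha.2 hc.2 hb.2
    · omega
    · exact key h2 h1 hb.1 hc.2 ha.2 hb.2
    · exact key h1 h2 hc.1 hb.2 ha.2 hc.2
    · omega
    · exact key h3 h2 ha.1 hb.2 hc.2 ha.2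
    · exact key h3 h1 ha.1 hc.2 hb.2 ha.2
  rw [Finset.sum_congr rfl hl] at h
  have := Finset.sum_le_sum hr
  simp only [Finset.sum_const, Finset.card_range, smul_eq_mul, Finset.card_univ] at h this
  rw [h, mul_comm 2]
  exact this

/-- If common neighbours `w ≠ w'` of `x` and `y` share a neighbour `u` outside `{x, y}`, then `w x y
w' u` is a pentagon. Four common neighbours would therefore have disjoint neighbourhoods off `{x,
y}`, of size at least `d - 2` each. -/
theorem card_common_neighbors_le_three (hG : (cycleGraph 5).Free G)
    (hd : G.IsRegularOfDegree d) (hn : Fintype.card V < 4 * (d - 2)) {x y : V} (hxy : G.Adj x y) :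
    (G.neighborFinset x ∩ G.neighborFinset y).card ≤ 3 := by
  by_contra hlt
  obtain ⟨s, hs, hs4⟩ := Finset.exists_subset_card_eq (Nat.succ_le_of_lt (not_le.1 hlt))
  have hmem : ∀ w ∈ s, G.Adj x w ∧ G.Adj y w := fun w hw => by simpa using hs hw
  have hdisj : (s : Set V).PairwiseDisjoint (fun w => G.neighborFinset w \ {x, y}) := by
    intro w hw w' hw' hne
    rw [Function.onFun, Finset.disjoint_left]
    intro u hu hu'
    simp only [Finset.mem_sdiff, mem_neighborFinset, Finset.mem_insert, Finset.mem_singleton,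
      not_or] at hu hu'
    exact hG (cycleGraph_five_isContained (hmem w hw).1.symm hxy (hmem w' hw').2 hu'.1
      hu.1.symm (hmem w hw).2.ne.symm hne (hmem w' hw').1.ne (Ne.symm hu.2.1) (Ne.symm hu.2.2))
  have hcard := Finset.card_biUnion hdisj
  have hge : ∑ w ∈ s, (d - 2) ≤ ∑ w ∈ s, (G.neighborFinset w \ {x, y}).card := by
    refine Finset.sum_le_sum fun w _ => ?_
    have h1 := Finset.le_card_sdiff {x, y} (G.neighborFinset w)
    rw [card_neighborFinset_eq_degree, hd w] at h1
    have h2 : ({x, y} : Finset V).card ≤ 2 := Finset.card_le_two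
    omega
  rw [Finset.sum_const, hs4, smul_eq_mul, ← hcard] at hge
  have := Finset.card_le_univ (s.biUnion fun w => G.neighborFinset w \ {x, y})
  omega

/-- With a fourth vertex `a` adjacent to `x`, the neighbourhoods of `x`, `y`, `z`, `a` have pairwise
intersections of total size at most `3 + 3 + 3 + 3 + 2 + 2 = 16`, so their union has at least `4 * d
- 16` vertices. -/
theorem not_triangle_of_cycleGraph_five_free (hG : (cycleGraph 5).Free G)
    (hd : G.IsRegularOfDegree d) (hn : Fintype.card V + 18 < 4 * d) {x y z : V}
    (hxy : G.Adj x y) (hyz : G.Adj y z) (hxz : G.Adj x z) : False := by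
  have hcod : ∀ {u v : V}, G.Adj u v → (G.neighborFinset u ∩ G.neighborFinset v).card ≤ 3 :=
    fun h => card_common_neighbors_le_three hG hd (by omega) h
  have hdeg : ∀ v, (G.neighborFinset v).card = d := fun v => by
    rw [card_neighborFinset_eq_degree, hd v]
  have hcard : d ≤ Fintype.card V := by
    rw [← hdeg x]; exact Finset.card_le_univ _
  obtain ⟨a, ha⟩ : (G.neighborFinset x \ {y, z}).Nonempty := by
    rw [← Finset.card_pos]
    have h1 := Finset.le_card_sdiff {y, z} (G.neighborFinset x)
    have h2 : ({y, z} : Finset V).card ≤ 2 := Finset.card_le_two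
    rw [hdeg] at h1
    omega
  simp only [Finset.mem_sdiff, mem_neighborFinset, Finset.mem_insert, Finset.mem_singleton,
    not_or] at ha
  -- A common neighbour `u` of `p` and `a` outside `{x, q}` closes the pentagon `a x q p u`.
  have hout : ∀ {p q : V}, G.Adj x p → G.Adj p q → G.Adj q x → a ≠ p → a ≠ q →
      (G.neighborFinset p ∩ G.neighborFinset a).card ≤ 2 := by
    intro p q hxp hpq hqx hap haq
    refine (Finset.card_le_card (t := {x, q}) fun u hu => ?_).trans Finset.card_le_two
    simp only [Finset.mem_inter, mem_neighborFinset, Finset.mem_insert,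
      Finset.mem_singleton] at hu ⊢
    by_contra hne
    rw [not_or] at hne
    exact hG (cycleGraph_five_isContained ha.1.symm hqx.symm hpq.symm hu.1 hu.2.symm
      haq hap hxp.ne (Ne.symm hne.1) (Ne.symm hne.2))
  have hya := hout hxy hyz hxz.symm ha.2.1 ha.2.2
  have hza := hout hxz hyz.symm hxy.symm ha.2.2 ha.2.1
  have hxa := hcod ha.1
  have e1 := Finset.card_union_add_card_inter (G.neighborFinset x) (G.neighborFinset y)
  have e2 := Finset.card_union_add_card_inter (G.neighborFinset x ∪ G.neighborFinset y)
    (G.neighborFinset z)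
  have e3 := Finset.card_union_add_card_inter
    (G.neighborFinset x ∪ G.neighborFinset y ∪ G.neighborFinset z) (G.neighborFinset a)
  rw [Finset.union_inter_distrib_right] at e2 e3
  rw [Finset.union_inter_distrib_right] at e3
  have i1 := hcod hxy
  have i2 := (Finset.card_union_le _ _).trans (Nat.add_le_add (hcod hxz) (hcod hyz))
  have i3 := (Finset.card_union_le _ _).trans
    (Nat.add_le_add ((Finset.card_union_le _ _).trans (Nat.add_le_add hxa hya)) hza)
  have hu := Finset.card_le_univ
    (G.neighborFinset x ∪ G.neighborFinset y ∪ G.neighborFinset z ∪ G.neighborFinset a)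
  simp only [hdeg] at e1 e2 e3
  omega

omit [DecidableEq V] in
theorem IsRegularOfDegree.even_card_of_isBipartite (hd : G.IsRegularOfDegree d) (hd0 : 0 < d)
    (hb : G.IsBipartite) : Even (Fintype.card V) := by
  obtain ⟨C⟩ := hb
  have hbip : G.IsBipartiteWith
      ((Finset.univ.filter fun v => C v = 0 : Finset V) : Set V)
      ((Finset.univ.filter fun v => ¬ C v = 0 : Finset V) : Set V) := by
    refine ⟨by rw [Finset.disjoint_coe]; exact Finset.disjoint_filter_filter_not _ _ _, ?_⟩
    intro v w h
    have := C.valid h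
    simp only [Finset.coe_filter, Finset.mem_univ, true_and, Set.mem_ofPred_eq]
    omega
  have h := isBipartiteWith_sum_degrees_eq hbip
  simp only [hd.degree_eq, Finset.sum_const, smul_eq_mul] at h
  have h' := Nat.eq_of_mul_eq_mul_right hd0 h
  have := Finset.card_filter_add_card_filter_not (s := (Finset.univ : Finset V))
    (fun v => C v = 0)
  rw [← h', Finset.card_univ] at this
  exact ⟨_, this.symm⟩

/-- A regular graph of large odd order `n` and degree exceeding `2 n / 7` contains a pentagon. -/
theorem IsRegularOfDegree.cycleGraph_five_isContained (hd : G.IsRegularOfDegree d)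
    (hodd : Odd (Fintype.card V)) (hn : 126 ≤ Fintype.card V)
    (hdn : 2 * Fintype.card V < 7 * d) : cycleGraph 5 ⊑ G := by
  by_contra hG
  -- Since `7 * d > 2 * n`, `4 * d` exceeds `n + n / 7`, and `126 = 7 * 18` supplies the slack of
  -- 18.
  have htri : ∀ {x y z : V}, G.Adj x y → G.Adj y z → G.Adj x z → False :=
    fun h1 h2 h3 => not_triangle_of_cycleGraph_five_free hG hd (by omega) h1 h2 h3
  have hnb : ¬ G.Colorable 2 := fun h =>
    Nat.not_even_iff_odd.2 hodd (hd.even_card_of_isBipartite (by omega) h)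
  rw [two_colorable_iff_forall_loop_even] at hnb
  have hex : ∃ m, ∃ (u : V) (w : G.Walk u u), w.length = m ∧ Odd m := by
    push Not at hnb
    obtain ⟨u, w, hw⟩ := hnb
    exact ⟨_, u, w, rfl, by simpa using hw⟩
  classical
  obtain ⟨u, w, hwl, hm⟩ := Nat.find_spec hex
  have hmin : ∀ (x : V) (p : G.Walk x x), Odd p.length → w.length ≤ p.length := by
    intro x p hp
    rw [hwl]
    exact Nat.find_min' hex ⟨x, p, rfl, hp⟩
  rw [← hwl] at hm
  clear hwl
  have adj : ∀ i, i < w.length → G.Adj (w.getVert i) (w.getVert (i + 1)) :=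
    fun i hi => w.adj_getVert_succ hi
  have hend : w.getVert w.length = w.getVert 0 := by simp
  rcases lt_or_ge w.length 5 with h5 | h5
  · obtain h1 | h3 : w.length = 1 ∨ w.length = 3 := by
      obtain ⟨k, hk⟩ := hm; omega
    · have := adj 0 (by omega)
      rw [h1] at hend
      rw [zero_add, hend] at this
      exact this.ne rfl
    · rw [h3] at hend
      exact htri (adj 0 (by omega)) (adj 1 (by omega)) (hend ▸ (adj 2 (by omega)).symm)
  · have hle := w.length_mul_le_of_shortest_odd hm h5 hmin hd
    have h5' : w.length = 5 := by
      by_contra hne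
      have : 7 ≤ w.length := by obtain ⟨k, hk⟩ := hm; omega
      have := Nat.mul_le_mul_right d this
      omega
    rw [h5'] at hend
    have a0 := adj 0 (by omega)
    have a1 := adj 1 (by omega)
    have a2 := adj 2 (by omega)
    have a3 := adj 3 (by omega)
    have a4 := adj 4 (by omega)
    simp only [zero_add, Nat.reduceAdd] at a0 a1 a2 a3 a4
    rw [hend] at a4
    -- Identifying two non-consecutive vertices of a closed walk of length 5 leaves a triangle.
    refine hG (SimpleGraph.cycleGraph_five_isContained a0 a1 a2 a3 a4 ?_ ?_ ?_ ?_ ?_) <;> intro h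
    · exact htri (h ▸ a2) a3 a4.symm
    · exact htri a0 a1 (h ▸ a2.symm)
    · exact htri (h ▸ a3) a4 a0.symm
    · exact htri a1 a2 (h ▸ a3.symm)
    · exact htri (h ▸ a4) a0 a1.symm

end Pentagon

/-! ### Greedy extension of a pentagon to a unicyclic graph. -/

section Unicyclic

variable {W : Type*} {F : SimpleGraph W}

/-- Every path of `F` joining two points of `S` stays in `S`. -/
def IsPathConvex (F : SimpleGraph W) (S : Set W) : Prop :=
  ∀ a ∈ S, ∀ b ∈ S, ∀ p : F.Walk a b, p.IsPath → ∀ w ∈ p.support, w ∈ S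

variable {v : W} {c : F.Walk v v}

theorem Walk.IsCycle.mem_edges_iff_of_unique
    (huniq : ∀ (w : W) (c' : F.Walk w w), c'.IsCycle → c'.toSubgraph = c.toSubgraph)
    {w : W} {c' : F.Walk w w} (hc' : c'.IsCycle) (e : Sym2 W) : e ∈ c'.edges ↔ e ∈ c.edges := by
  rw [← Walk.mem_edges_toSubgraph, huniq w c' hc', Walk.mem_edges_toSubgraph]

theorem Walk.IsCycle.support_subset_of_unique
    (huniq : ∀ (w : W) (c' : F.Walk w w), c'.IsCycle → c'.toSubgraph = c.toSubgraph)
    {w : W} {c' : F.Walk w w} (hc' : c'.IsCycle) {x : W} (hx : x ∈ c'.support) :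
    x ∈ c.support := by
  rwa [← Walk.mem_verts_toSubgraph, huniq w c' hc', Walk.mem_verts_toSubgraph] at hx

theorem Walk.IsCycle.isAcyclic_deleteEdges_of_unique
    (huniq : ∀ (w : W) (c' : F.Walk w w), c'.IsCycle → c'.toSubgraph = c.toSubgraph)
    {e : Sym2 W} (he : e ∈ c.edges) : (F.deleteEdges {e}).IsAcyclic := by
  intro w c' hc'
  have hle : F.deleteEdges {e} ≤ F := deleteEdges_le _
  have h := (Walk.IsCycle.mem_edges_iff_of_unique huniq (hc'.mapLe hle) e).2 he
  rw [Walk.edges_mapLe_eq_edges] at h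
  have := c'.edges_subset_edgeSet h
  simp [edgeSet_deleteEdges] at this

/-- The path `p` uses only one edge at its start `a`, so the cycle can be traversed from `a` in a
direction whose first edge avoids `p`. Deleting that edge leaves a forest containing both `p` and
the remaining arc from `a` to `b`, and paths in a forest are unique. -/
theorem Walk.IsCycle.edges_subset_of_unique (hc : c.IsCycle)
    (huniq : ∀ (w : W) (c' : F.Walk w w), c'.IsCycle → c'.toSubgraph = c.toSubgraph)
    {a b : W} (hab : a ≠ b) (ha : a ∈ c.support) (hb : b ∈ c.support) {p : F.Walk a b}
    (hp : p.IsPath) : p.edges ⊆ c.edges := by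
  classical
  obtain ⟨c₁, hc₁, hnot⟩ : ∃ c₁ : F.Walk a a, c₁.IsCycle ∧ s(a, c₁.snd) ∉ p.edges := by
    have hr : (c.rotate a ha).IsCycle := hc.rotate ha
    by_cases h : s(a, (c.rotate a ha).snd) ∈ p.edges
    · refine ⟨_, hr.reverse, fun h' => hr.snd_ne_penultimate ?_⟩
      rw [Walk.snd_reverse] at h'
      rw [hp.eq_snd_of_mem_edges h, hp.eq_snd_of_mem_edges h']
    · exact ⟨_, hr, h⟩
  have hb₁ : b ∈ c₁.support := by
    rw [← Walk.mem_verts_toSubgraph, huniq a c₁ hc₁, Walk.mem_verts_toSubgraph]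
    exact hb
  have hsub : ∀ e, e ∈ c₁.edges → e ∈ c.edges :=
    fun e => (Walk.IsCycle.mem_edges_iff_of_unique huniq hc₁ e).1
  cases c₁ with
  | nil => exact absurd hc₁ (by simp)
  | @cons _ x _ h q =>
    rw [Walk.cons_isCycle_iff] at hc₁
    simp only [Walk.snd_cons] at hnot
    have hbq : b ∈ q.support := by
      rw [Walk.support_cons, List.mem_cons] at hb₁
      exact hb₁.resolve_left hab.symm
    have hac := Walk.IsCycle.isAcyclic_deleteEdges_of_unique huniq
      (hsub s(a, x) (by simp))
    have hr : ((q.dropUntil b hbq).reverse).IsPath := (hc₁.1.dropUntil hbq).reverse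
    have hrsub : ∀ e ∈ ((q.dropUntil b hbq).reverse).edges, e ∈ q.edges := by
      intro e he
      rw [Walk.edges_reverse, List.mem_reverse] at he
      exact q.edges_dropUntil_subset_edges hbq he
    have hmem : ∀ {y z : W} (r : F.Walk y z), s(a, x) ∉ r.edges →
        ∀ e ∈ r.edges, e ∈ (F.deleteEdges {s(a, x)}).edgeSet := by
      intro y z r hr' e he
      rw [edgeSet_deleteEdges]
      refine ⟨r.edges_subset_edgeSet he, fun h' => hr' ?_⟩
      rw [Set.mem_singleton_iff] at h'
      exact h' ▸ he
    have h1 := hmem p hnot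
    have h2 := hmem _ (fun h' => hc₁.2 (hrsub _ h'))
    have heq := (hac.subsingleton_path a b).elim ⟨p.transfer _ h1, hp.transfer h1⟩
      ⟨(q.dropUntil b hbq).reverse.transfer _ h2, hr.transfer h2⟩
    have heq' := congrArg (fun r : (F.deleteEdges {s(a, x)}).Path a b => r.1.edges) heq
    simp only [Walk.edges_transfer] at heq'
    intro e he
    rw [heq'] at he
    exact hsub e (by rw [Walk.edges_cons]; exact List.mem_cons_of_mem _ (hrsub e he))

theorem Walk.IsCycle.isPathConvex_of_unique (hc : c.IsCycle)
    (huniq : ∀ (w : W) (c' : F.Walk w w), c'.IsCycle → c'.toSubgraph = c.toSubgraph) :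
    F.IsPathConvex {w | w ∈ c.support} := by
  intro a ha b hb p hp w hw
  by_cases hab : a = b
  · subst hab
    rw [(Walk.isPath_iff_nil.1 hp).eq_nil] at hw
    rw [Walk.support_nil, List.mem_singleton] at hw
    exact hw ▸ ha
  · rw [Walk.mem_support_iff_exists_mem_edges_of_not_nil (Walk.not_nil_of_ne hab)] at hw
    obtain ⟨e, he, hwe⟩ := hw
    exact Walk.mem_support_of_mem_edges (hc.edges_subset_of_unique huniq hab ha hb hp he) hwe

theorem Walk.IsCycle.mem_edges_of_adj_of_unique (hc : c.IsCycle)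
    (huniq : ∀ (w : W) (c' : F.Walk w w), c'.IsCycle → c'.toSubgraph = c.toSubgraph)
    {a b : W} (ha : a ∈ c.support) (hb : b ∈ c.support) (hab : F.Adj a b) :
    s(a, b) ∈ c.edges :=
  hc.edges_subset_of_unique huniq hab.ne ha hb (p := hab.toWalk)
    (by simp [Walk.cons_isPath_iff, hab.ne]) (by simp)

/-- A path from `S` to `x` that avoids `a` extends by the edge `x a` to a path between points of `S`
through `x ∉ S`. One that meets `a` must finish along the edge `a x`, since any other finish would
close a cycle through `x`. -/
theorem IsPathConvex.insert_of_adj {S : Set W} (hS : F.IsPathConvex S)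
    (hcyc : ∀ (w : W) (c' : F.Walk w w), c'.IsCycle → w ∈ S) {a x : W} (ha : a ∈ S) (hx : x ∉ S)
    (hax : F.Adj a x) : F.IsPathConvex (insert x S) := by
  classical
  have key : ∀ b ∈ S, ∀ p : F.Walk b x, p.IsPath → ∀ w ∈ p.support, w ∈ insert x S := by
    intro b hb p hp w hw
    by_cases hap : a ∈ p.support
    · rw [← Walk.take_spec p hap, Walk.mem_support_append_iff] at hw
      rcases hw with hw | hw
      · exact Or.inr (hS b hb a ha _ (hp.takeUntil hap) w hw)
      · by_cases hedge : s(a, x) ∈ (p.dropUntil a hap).edges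
        · rw [(hp.dropUntil hap).eq_adj_toWalk_of_mem_edges hedge] at hw
          simp only [Walk.support_cons, Walk.support_nil, List.mem_cons, List.not_mem_nil,
            or_false] at hw
          rcases hw with rfl | rfl
          · exact Or.inr ha
          · exact Or.inl rfl
        · refine absurd (hcyc x (Walk.cons hax.symm (p.dropUntil a hap)) ?_) hx
          rw [Walk.cons_isCycle_iff, Sym2.eq_swap]
          exact ⟨hp.dropUntil hap, hedge⟩
    · exact absurd (hS b hb a ha _ (hp.concat hap hax.symm) x (by simp)) hx
  intro s hs t ht p hp w hw
  rcases hs with rfl | hs <;> rcases ht with rfl | ht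
  · rw [(Walk.isPath_iff_nil.1 hp).eq_nil] at hw
    simp only [Walk.support_nil, List.mem_singleton] at hw
    exact Or.inl hw
  · exact key t ht p.reverse hp.reverse w (by simpa using hw)
  · exact key s hs p hp w hw
  · exact Or.inr (hS s hs t ht p hp w hw)

/-- Here `S` is a union of components, so no walk joins `x` to it unless `x` already lies in it. -/
theorem IsPathConvex.insert_of_not_adj {S : Set W} (hS : F.IsPathConvex S)
    (hadj : ∀ a ∈ S, ∀ x, x ∉ S → ¬ F.Adj a x) (x : W) : F.IsPathConvex (insert x S) := by
  have stay : ∀ {s t : W} (_ : F.Walk s t), s ∈ S → t ∈ S := by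
    intro s t p
    induction p with
    | nil => exact id
    | cons h _ ih => exact fun hs => ih (by_contra fun hn => hadj _ hs _ hn h)
  intro s hs t ht p hp w hw
  rcases hs with rfl | hs <;> rcases ht with rfl | ht
  · rw [(Walk.isPath_iff_nil.1 hp).eq_nil] at hw
    simp only [Walk.support_nil, List.mem_singleton] at hw
    exact Or.inl hw
  · exact Or.inr (hS s (stay p.reverse ht) t ht p hp w hw)
  · exact Or.inr (hS s hs t (stay p hs) p hp w hw)
  · exact Or.inr (hS s hs t ht p hp w hw)

theorem IsPathConvex.eq_of_adj {S : Set W} (hS : F.IsPathConvex S) {a b x : W} (ha : a ∈ S)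
    (hb : b ∈ S) (hx : x ∉ S) (hax : F.Adj a x) (hbx : F.Adj b x) : b = a := by
  by_contra hne
  refine hx (hS a ha b hb (Walk.cons hax hbx.symm.toWalk) ?_ x (by simp))
  simp [Walk.cons_isPath_iff, hax.ne, hbx.ne.symm, Ne.symm hne]

/-- The greedy step: the new vertex imposes at most one adjacency towards `S`. If no edge leaves
`S`, the vertex `a` is arbitrary. -/
theorem IsPathConvex.exists_insert {S : Set W} (hS : F.IsPathConvex S)
    (hcyc : ∀ (w : W) (c' : F.Walk w w), c'.IsCycle → w ∈ S) (hne : S.Nonempty)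
    (huniv : S ≠ Set.univ) :
    ∃ x, x ∉ S ∧ F.IsPathConvex (insert x S) ∧ ∃ a ∈ S, ∀ b ∈ S, F.Adj b x → b = a := by
  by_cases h : ∃ a ∈ S, ∃ x, x ∉ S ∧ F.Adj a x
  · obtain ⟨a, ha, x, hx, hax⟩ := h
    exact ⟨x, hx, hS.insert_of_adj hcyc ha hx hax, a, ha,
      fun b hb hbx => hS.eq_of_adj ha hb hx hax hbx⟩
  · push Not at h
    obtain ⟨x, hx⟩ := (Set.ne_univ_iff_exists_notMem S).1 huniv
    obtain ⟨a, ha⟩ := hne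
    exact ⟨x, hx, hS.insert_of_not_adj h x, a, ha, fun b hb hbx => absurd hbx (h b hb x hx)⟩

variable [Finite W] {V : Type*} [Fintype V] {G : SimpleGraph V} [DecidableRel G.Adj]

/-- A partial copy of `F` on a path-convex set meeting all cycles extends greedily. -/
theorem IsPathConvex.isContained (hdeg : ∀ u, Nat.card W ≤ G.degree u) (S : Set W)
    (hS : F.IsPathConvex S) (hcyc : ∀ (w : W) (c' : F.Walk w w), c'.IsCycle → w ∈ S)
    (hne : S.Nonempty) (f : W → V) (hinj : Set.InjOn f S)
    (hf : ∀ a ∈ S, ∀ b ∈ S, F.Adj a b → G.Adj (f a) (f b)) : F ⊑ G := by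
  classical
  induction hk : Sᶜ.ncard using Nat.strong_induction_on generalizing S f with
  | _ k ih =>
    by_cases huniv : S = Set.univ
    · subst huniv
      exact ⟨⟨⟨f, fun h => hf _ trivial _ trivial h⟩, Set.injOn_univ.1 hinj⟩⟩
    obtain ⟨x, hx, hconv, a, ha, hax⟩ := hS.exists_insert hcyc hne huniv
    have hlt : S.ncard < Nat.card W := by
      rw [← Set.ncard_univ]
      exact Set.ncard_lt_ncard (Set.ssubset_univ_iff.2 huniv)
    -- Any unused neighbour of `f a` can be the image of `x`. One exists because fewer than
    -- `Nat.card W` vertices are occupied.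
    obtain ⟨u, hu, huS⟩ : ∃ u ∈ (G.neighborFinset (f a) : Set V), u ∉ f '' S := by
      by_contra! hsub
      have h1 := Set.ncard_le_ncard (show (G.neighborFinset (f a) : Set V) ⊆ f '' S from hsub)
      rw [Set.ncard_coe_finset, card_neighborFinset_eq_degree] at h1
      have h2 := Set.ncard_image_le (f := f) S.toFinite
      have h3 := hdeg (f a)
      omega
    rw [Finset.mem_coe, mem_neighborFinset] at hu
    have hupd : ∀ b ∈ S, Function.update f x u b = f b := fun b hb =>
      Function.update_of_ne (ne_of_mem_of_not_mem hb hx) _ _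
    refine ih _ ?_ (insert x S) hconv (fun w c' hc' => Or.inr (hcyc w c' hc'))
      (Set.insert_nonempty _ _) (Function.update f x u) ?_ ?_ rfl
    · rw [← hk]
      exact Set.ncard_lt_ncard (compl_lt_compl_iff_lt.2 (Set.ssubset_insert hx))
    · rw [Set.injOn_insert hx]
      refine ⟨hinj.congr fun b hb => (hupd b hb).symm, ?_⟩
      rw [Function.update_self, Set.image_congr hupd]
      exact huS
    · rintro s (rfl | hs) t (rfl | ht) hst
      · exact absurd hst (F.irrefl)
      · rw [Function.update_self, hupd t ht, hax t ht hst.symm]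
        exact hu.symm
      · rw [Function.update_self, hupd s hs, hax s hs hst]
        exact hu
      · rw [hupd s hs, hupd t ht]
        exact hf s hs t ht hst

omit [Finite W] in
theorem Walk.IsCycle.exists_getVert_eq {v : W} {c : F.Walk v v} (hlen : 0 < c.length) {w : W}
    (hw : w ∈ c.support) : ∃ i < c.length, c.getVert i = w := by
  obtain ⟨i, rfl, hi⟩ := Walk.mem_support_iff_exists_getVert.1 hw
  rcases hi.lt_or_eq with h | rfl
  · exact ⟨i, h, rfl⟩
  · exact ⟨0, hlen, by simp⟩

/-- A graph of large minimum degree that contains a pentagon contains every unicyclic graph whose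
cycle is a pentagon. -/
theorem isContained_of_isUnicyclicWith_five (hF : IsUnicyclicWith F 5)
    (hdeg : ∀ u, Nat.card W ≤ G.degree u) (hG : cycleGraph 5 ⊑ G) : F ⊑ G := by
  have hpath : ∀ (i : ℕ) (h : i < 4),
      (cycleGraph 5).Adj ⟨i, h.trans (by omega)⟩ ⟨i + 1, Nat.succ_lt_succ h⟩ := by decide
  have hback : (cycleGraph 5).Adj 4 0 := by decide
  obtain ⟨v, c, hc, hlen, huniq⟩ := hF
  obtain ⟨φ⟩ := hG
  -- The index 0 off the cycle is a filler: only values on the cycle enter the partial copy.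
  have hex : ∀ w : W, ∃ i : Fin 5, w ∈ c.support → c.getVert i = w := by
    intro w
    by_cases hw : w ∈ c.support
    · obtain ⟨i, hi, h⟩ := Walk.IsCycle.exists_getVert_eq (by omega) hw
      exact ⟨⟨i, hlen ▸ hi⟩, fun _ => h⟩
    · exact ⟨0, fun h => absurd h hw⟩
  choose idx hidx using hex
  have hidx_get : ∀ i (hi : i < 5), idx (c.getVert i) = ⟨i, hi⟩ := by
    intro i hi
    have h := hidx (c.getVert i) (c.getVert_mem_support i)
    have hlt := (idx (c.getVert i)).isLt
    exact Fin.ext (hc.getVert_injOn' (by simp only [Set.mem_ofPred_eq]; omega)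
      (by simp only [Set.mem_ofPred_eq]; omega) h)
  have hend : c.getVert 5 = c.getVert 0 := by rw [← hlen]; simp
  have hsucc : ∀ i < 5, (cycleGraph 5).Adj (idx (c.getVert i)) (idx (c.getVert (i + 1))) := by
    intro i hi
    rcases (Nat.lt_succ_iff.1 hi).lt_or_eq with h | rfl
    · rw [hidx_get i hi, hidx_get (i + 1) (by omega)]
      exact hpath i h
    · rw [hend, hidx_get 4 (by omega), hidx_get 0 (by omega)]
      exact hback
  refine (hc.isPathConvex_of_unique huniq).isContained hdeg _
    (fun w c' hc' => Walk.IsCycle.support_subset_of_unique huniq hc' c'.start_mem_support)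
    ⟨v, c.start_mem_support⟩ (fun w => φ (idx w)) ?_ ?_
  · intro a ha b hb hab
    rw [← hidx a ha, ← hidx b hb, φ.injective hab]
  · intro a ha b hb hab
    -- The cycle has no chord, so an edge between two of its vertices joins consecutive ones.
    obtain ⟨i, hi, h⟩ := (Walk.mk_mem_edges_iff_exists c).1
      (hc.mem_edges_of_adj_of_unique huniq ha hb hab)
    rw [hlen] at hi
    have := φ.toHom.map_adj (hsucc i hi)
    rcases Sym2.eq_iff.1 h with ⟨rfl, rfl⟩ | ⟨rfl, rfl⟩
    · exact this
    · exact this.symm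

end Unicyclic

/-! ### Translating degree bounds into bounds on `rex`. -/

section Rex

variable {W : Type*} {F : SimpleGraph W}

theorem mul_le_two_mul_rex {V : Type*} [Fintype V] {G : SimpleGraph V} [DecidableRel G.Adj]
    {d : ℕ} (hd : G.IsRegularOfDegree d) (hF : F.Free G) :
    Fintype.card V * d ≤ 2 * rex (Fintype.card V) F := by
  classical
  let e : G ≃g G.overFin rfl := G.overFinIso rfl
  have hd' : (G.overFin rfl).IsRegularOfDegree d := by
    intro v
    rw [← e.apply_symm_apply v, e.degree_eq]
    exact hd _
  have hF' : F.Free (G.overFin rfl) := fun h => hF (h.trans ⟨e.symm.toCopy⟩)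
  have hsum := (G.overFin rfl).sum_degrees_eq_twice_card_edges
  simp only [hd'.degree_eq, Finset.sum_const, Finset.card_univ, Fintype.card_fin,
    smul_eq_mul] at hsum
  rw [hsum]
  refine Nat.mul_le_mul_left 2 ?_
  unfold rex
  refine (le_of_eq ?_).trans (Finset.le_sup (b := G.overFin rfl)
    (Finset.mem_filter.2 ⟨Finset.mem_univ _, hF', d, ?_⟩))
  · congr!
  · convert hd'

theorem rex_le {n q : ℕ} (h : ∀ (G : SimpleGraph (Fin n)) [DecidableRel G.Adj] (d : ℕ),
    G.IsRegularOfDegree d → F.Free G → d ≤ 2 * q) : rex n F ≤ n * q := by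
  classical
  unfold rex
  refine Finset.sup_le fun G hG => ?_
  obtain ⟨hF, d, hd⟩ := (Finset.mem_filter.1 hG).2
  have hsum := G.sum_degrees_eq_twice_card_edges
  have hd' : ∀ v, G.degree v = d := fun v => by convert hd v
  simp only [hd', Finset.sum_const, Finset.card_univ, Fintype.card_fin, smul_eq_mul] at hsum
  have := Nat.mul_le_mul_left n (h G d hd' hF)
  have hcard : G.edgeFinset.card * 2 ≤ n * q * 2 := by
    rw [mul_comm, ← hsum]
    linarith
  convert Nat.le_of_mul_le_mul_right hcard two_pos

end Rex

/-! ### Regular subgraphs of blow-ups and their odd closed walks. -/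

section BlockGraph

variable {ι : Type*} (s : ι → ℕ) (D : ι → ι → ℕ)

/-- The graph with vertex blocks of sizes `s`, in which every vertex of block `b` has `D b b'`
neighbours in block `b'`. The pairs of blocks are empty, complete, or joined by a circulant. -/
def blockGraph (hdiag : ∀ b, D b b = 0)
    (hsymm : ∀ b b', (D b b' = 0 ∧ D b' b = 0) ∨ (s b' ≤ D b b' ∧ s b ≤ D b' b) ∨
      (s b = s b' ∧ D b b' = D b' b)) : SimpleGraph (Σ b, Fin (s b)) where
  -- The sum of the positions, rather than their difference, makes the circulant condition
  -- symmetric. It holds always once `D` reaches the block size and never for `D = 0`.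
  Adj v w := (v.2 + w.2 : ℕ) % s w.1 < D v.1 w.1
  symm := ⟨by
    rintro ⟨b, x⟩ ⟨b', y⟩ h
    dsimp only at h ⊢
    rcases hsymm b b' with h' | h' | h'
    · omega
    · exact (Nat.mod_lt _ (Fin.pos x)).trans_le h'.2
    · rw [← h'.2, add_comm]
      convert h using 2
      exact h'.1⟩
  loopless := ⟨by
    rintro ⟨b, x⟩ h
    simp [hdiag] at h⟩

theorem card_filter_add_mod_lt {m c : ℕ} (hc : c ≤ m) (x : ℕ) :
    (Finset.univ.filter fun y : Fin m => (x + y) % m < c).card = c := by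
  rcases Nat.eq_zero_or_pos m with rfl | hm
  · simp; omega
  have : NeZero m := ⟨hm.ne'⟩
  have h : (Finset.univ.filter fun y : Fin m => (x + y) % m < c).card =
      (Finset.univ.filter fun z : Fin m => (z : ℕ) < c).card := by
    refine Finset.card_equiv (Equiv.addLeft (Fin.ofNat m x)) fun y => ?_
    simp [Fin.val_add]
  rw [h, Fin.card_filter_val_lt, min_eq_right hc]

variable {s D}

instance decidableRelBlockGraphAdj {hdiag hsymm} :
    DecidableRel (blockGraph s D hdiag hsymm).Adj :=
  fun v w => inferInstanceAs (Decidable ((v.2 + w.2 : ℕ) % s w.1 < D v.1 w.1))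

theorem degree_blockGraph [Fintype ι] {hdiag hsymm} (hle : ∀ b b', D b b' ≤ s b')
    (v : Σ b, Fin (s b)) : (blockGraph s D hdiag hsymm).degree v = ∑ b, D v.1 b := by
  classical
  rw [← card_neighborFinset_eq_degree, neighborFinset_eq_filter, Finset.card_filter,
    Fintype.sum_sigma]
  refine Finset.sum_congr rfl fun b _ => ?_
  rw [← Finset.card_filter]
  exact card_filter_add_mod_lt (hle _ _) _

/-- Each step of the walk moves its image by `1` or `-1`; `t` is the integer lift of the total
displacement. On an odd closed walk `t` is odd and divisible by `k`, whence `|t| ≥ k`. -/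
theorem Walk.exists_int_of_zmod {V : Type*} {G : SimpleGraph V} {k : ℕ} {π : V → ZMod k}
    (hπ : ∀ v w, G.Adj v w → π w = π v + 1 ∨ π v = π w + 1) {u v : V} (p : G.Walk u v) :
    ∃ t : ℤ, |t| ≤ p.length ∧ Even (t + p.length) ∧ π v = π u + t := by
  induction p with
  | nil => exact ⟨0, by simp⟩
  | @cons u w v h p ih =>
    obtain ⟨t, ht, ⟨r, hr⟩, hv⟩ := ih
    rw [abs_le] at ht
    rcases hπ _ _ h with h' | h'
    · refine ⟨t + 1, abs_le.2 ?_, ⟨r + 1, ?_⟩, ?_⟩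
      · rw [Walk.length_cons]; push_cast; omega
      · rw [Walk.length_cons]; push_cast; omega
      · rw [hv, h']; push_cast; ring
    · refine ⟨t - 1, abs_le.2 ?_, ⟨r, ?_⟩, ?_⟩
      · rw [Walk.length_cons]; push_cast; omega
      · rw [Walk.length_cons]; push_cast; omega
      · rw [hv, h']; push_cast; ring

/-- A graph homomorphic to the cycle of length `k` has no odd closed walk shorter than `k`. -/
theorem Walk.le_length_of_zmod {V : Type*} {G : SimpleGraph V} {k : ℕ} {π : V → ZMod k}
    (hπ : ∀ v w, G.Adj v w → π w = π v + 1 ∨ π v = π w + 1) {u : V} (p : G.Walk u u)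
    (hp : Odd p.length) : k ≤ p.length := by
  obtain ⟨t, ht, ⟨r, hr⟩, hu⟩ := p.exists_int_of_zmod hπ
  have h0 : ((t : ℤ) : ZMod k) = 0 := by simpa using hu.symm
  rw [ZMod.intCast_zmod_eq_zero_iff_dvd] at h0
  have htne : t ≠ 0 := by
    rintro rfl
    obtain ⟨m, hm⟩ := hp
    omega
  have := Int.le_of_dvd (abs_pos.2 htne) ((dvd_abs _ _).2 h0)
  omega

variable {W : Type*} {F : SimpleGraph W}

theorem free_blockGraph {hdiag hsymm} {k : ℕ} {π : ι → ZMod k}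
    (hπ : ∀ b b', D b b' ≠ 0 → π b' = π b + 1 ∨ π b = π b' + 1) {w : W} (c : F.Walk w w)
    (hc : Odd c.length) (hck : c.length < k) : F.Free (blockGraph s D hdiag hsymm) := by
  rintro ⟨φ⟩
  have := (c.map φ.toHom).le_length_of_zmod (k := k) (π := fun v => π v.1)
    (fun v w h => hπ _ _ (Nat.ne_zero_of_lt h)) (by simpa using hc)
  rw [Walk.length_map] at this
  omega

theorem mul_le_rex_of_block [Fintype ι] (hdiag : ∀ b, D b b = 0)
    (hsymm : ∀ b b', (D b b' = 0 ∧ D b' b = 0) ∨ (s b' ≤ D b b' ∧ s b ≤ D b' b) ∨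
      (s b = s b' ∧ D b b' = D b' b)) (hle : ∀ b b', D b b' ≤ s b') {q n : ℕ}
    (hsum : ∀ b, ∑ b', D b b' = 2 * q) (hn : ∑ b, s b = n) {k : ℕ} {π : ι → ZMod k}
    (hπ : ∀ b b', D b b' ≠ 0 → π b' = π b + 1 ∨ π b = π b' + 1) {w : W} (c : F.Walk w w)
    (hc : Odd c.length) (hck : c.length < k) : n * q ≤ rex n F := by
  have hcard : Fintype.card (Σ b, Fin (s b)) = n := by simp [Fintype.card_sigma, hn]
  have h := mul_le_two_mul_rex (G := blockGraph s D hdiag hsymm) (d := 2 * q)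
    (fun v => by rw [degree_blockGraph hle, hsum]) (free_blockGraph hπ c hc hck)
  rw [hcard] at h
  linarith

end BlockGraph

/-! ### The two families of `2 * q`-regular blow-ups. -/

section Constructions

variable {W : Type*} {F : SimpleGraph W}

/-- Block sizes of the blow-up of a `k`-cycle with parts of size `q`, of which the two
consecutive parts `0` and `1` get `j` additional vertices each. -/
def evenBlockSize (k q j : ℕ) : ZMod k ⊕ Bool → ℕ
  | .inl _ => q
  | .inr _ => j

/-- Degrees between the blocks of a `2 q`-regular spanning subgraph of the blow-up with block
sizes `evenBlockSize k q j`. -/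
def evenBlockDegree (k q j : ℕ) : ZMod k ⊕ Bool → ZMod k ⊕ Bool → ℕ
  | .inl a, .inl b =>
    (if b = a + 1 then (if a = 1 ∨ a = -1 then q - j else q) else 0) +
      (if b = a - 1 then (if b = 1 ∨ b = -1 then q - j else q) else 0)
  | .inl a, .inr false => (if a = 1 then j else 0) + (if a = -1 then j else 0)
  | .inl a, .inr true => (if a = 0 then j else 0) + (if a = 2 then j else 0)
  | .inr false, .inl a => (if a = 1 then q else 0) + (if a = -1 then q else 0)
  | .inr true, .inl a => (if a = 0 then q else 0) + (if a = 2 then q else 0)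
  | .inr _, .inr _ => 0

/-- The part of the `k`-cycle to which a block belongs. -/
def evenBlockPart (k : ℕ) : ZMod k ⊕ Bool → ZMod k
  | .inl a => a
  | .inr false => 0
  | .inr true => 1

/-- The degree balance: the extra block of part 0 gives `j` more neighbours to parts `1` and `-1`,
and that of part 1 to parts `0` and `2`. Thinning the pairs `{1, 2}` and `{-1, 0}` to degree `q - j`
removes exactly this excess. -/
theorem ite_or_add_ite {q j : ℕ} (hj : j ≤ q) {P Q : Prop} [Decidable P] [Decidable Q]
    (hPQ : P → ¬ Q) :
    (if P ∨ Q then q - j else q) + ((if P then j else 0) + (if Q then j else 0)) = q := by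
  by_cases hP : P
  · simp [hP, hPQ hP, hj]
  · by_cases hQ : Q <;> simp [hP, hQ, hj]

theorem mul_le_rex_of_even {k q j : ℕ} (hk : 3 ≤ k) (hj : j ≤ q) {w : W} (c : F.Walk w w)
    (hc : Odd c.length) (hck : c.length < k) :
    (k * q + 2 * j) * q ≤ rex (k * q + 2 * j) F := by
  have : NeZero k := ⟨by omega⟩
  have h1 : (1 : ZMod k) ≠ 0 := by
    intro h
    have : ((1 : ℕ) : ZMod k) = 0 := by exact_mod_cast h
    rw [ZMod.natCast_eq_zero_iff] at this
    exact absurd (Nat.le_of_dvd (by omega) this) (by omega)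
  have h2 : (2 : ZMod k) ≠ 0 := by
    intro h
    have : ((2 : ℕ) : ZMod k) = 0 := by exact_mod_cast h
    rw [ZMod.natCast_eq_zero_iff] at this
    exact absurd (Nat.le_of_dvd (by omega) this) (by omega)
  have hneg : (1 : ZMod k) ≠ -1 := fun h => h2 (by linear_combination h)
  have hpm : ∀ a : ZMod k, a + 1 ≠ a - 1 := fun a h => h2 (by linear_combination h)
  refine mul_le_rex_of_block (s := evenBlockSize k q j) (D := evenBlockDegree k q j)
    (π := evenBlockPart k) ?_ ?_ ?_ ?_ ?_ ?_ c hc hck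
  · rintro (a | _ | _)
    · have e1 : a ≠ a + 1 := fun h => h1 (by linear_combination -h)
      have e2 : a ≠ a - 1 := fun h => h1 (by linear_combination h)
      simp [evenBlockDegree, e1, e2]
    · rfl
    · rfl
  · rintro (a | _ | _) (b | _ | _)
    · right; right
      refine ⟨rfl, ?_⟩
      have e1 : b = a + 1 ↔ a = b - 1 := ⟨fun h => by linear_combination -h,
        fun h => by linear_combination -h⟩
      have e2 : b = a - 1 ↔ a = b + 1 := ⟨fun h => by linear_combination -h,
        fun h => by linear_combination -h⟩
      simp only [evenBlockDegree, e1, e2]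
      rw [add_comm]
    all_goals
      simp only [evenBlockDegree, evenBlockSize]
      try split_ifs
      all_goals simp
  · rintro (a | _ | _) (b | _ | _) <;> simp only [evenBlockDegree, evenBlockSize]
    · by_cases hb : b = a + 1
      · rw [if_pos hb, if_neg (fun h => hpm a (hb.symm.trans h))]
        split_ifs <;> omega
      · rw [if_neg hb]
        split_ifs <;> omega
    · by_cases ha : a = 1
      · rw [if_pos ha, if_neg (fun h => hneg (ha.symm.trans h))]; rfl
      · rw [if_neg ha]; split_ifs <;> omega
    · by_cases ha : a = 0
      · rw [if_pos ha, if_neg (fun h => h2 (h.symm.trans ha))]; rfl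
      · rw [if_neg ha]; split_ifs <;> omega
    · by_cases ha : b = 1
      · rw [if_pos ha, if_neg (fun h => hneg (ha.symm.trans h))]; rfl
      · rw [if_neg ha]; split_ifs <;> omega
    all_goals try omega
    · by_cases ha : b = 0
      · rw [if_pos ha, if_neg (fun h => h2 (h.symm.trans ha))]; rfl
      · rw [if_neg ha]; split_ifs <;> omega
  · rintro (a | _ | _) <;>
      simp only [Fintype.sum_sum_type, Fintype.sum_bool, evenBlockDegree,
        Finset.sum_add_distrib, Finset.sum_ite_eq', Finset.mem_univ, if_true,
        Finset.sum_const_zero]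
    · have e1 : a - 1 = 1 ↔ a = 2 := ⟨fun h => by linear_combination h,
        fun h => by linear_combination h⟩
      have e2 : a - 1 = -1 ↔ a = 0 := ⟨fun h => by linear_combination h,
        fun h => by linear_combination h⟩
      have s1 := ite_or_add_ite hj (P := a = 1) (Q := a = -1) fun h h' => hneg (h.symm.trans h')
      have s2 := ite_or_add_ite hj (P := a = 2) (Q := a = 0) fun h h' => h2 (h.symm.trans h')
      simp only [e1, e2]
      omega
    · omega
    · omega
  · simp only [Fintype.sum_sum_type, evenBlockSize, Finset.sum_const,
      Finset.card_univ, ZMod.card, Fintype.card_bool, smul_eq_mul]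
  · rintro (a | _ | _) (b | _ | _) h <;> simp only [evenBlockDegree, evenBlockPart] at h ⊢
    · by_cases hb : b = a + 1
      · exact Or.inl hb
      · by_cases hb' : b = a - 1
        · exact Or.inr (by linear_combination -hb')
        · simp [hb, hb'] at h
    · by_cases ha : a = 1
      · right; rw [ha]; ring
      · by_cases ha' : a = -1
        · left; rw [ha']; ring
        · simp [ha, ha'] at h
    · by_cases ha : a = 0
      · left; rw [ha]; ring
      · by_cases ha' : a = 2
        · right; rw [ha']; ring
        · simp [ha, ha'] at h
    · by_cases ha : b = 1
      · left; rw [ha]; ring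
      · by_cases ha' : b = -1
        · right; rw [ha']; ring
        · simp [ha, ha'] at h
    · exact absurd rfl h
    · exact absurd rfl h
    · by_cases ha : b = 0
      · right; rw [ha]; ring
      · by_cases ha' : b = 2
        · left; rw [ha']; ring
        · simp [ha, ha'] at h
    · exact absurd rfl h
    · exact absurd rfl h

/-- Block sizes of a blow-up of the `7`-cycle; see `oddBlockPart`. -/
def oddBlockSize (q j : ℕ) : Fin 11 → ℕ := ![q, q, q, q - 1, q, q, q, j, j, 1, 1]

/-- The part of the `7`-cycle to which a block belongs. -/
def oddBlockPart : Fin 11 → ZMod 7 := ![0, 1, 2, 3, 4, 5, 6, 6, 0, 5, 1]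

/-- How two blocks are joined: `0` stands for empty, `1` for complete, `2` and `3` for regular of
degree `q - j` and `q - 1`. -/
def oddBlockKind : Fin 11 → Fin 11 → Fin 4 :=
  ![![0, 2, 0, 0, 0, 0, 3, 1, 0, 0, 1],
    ![2, 0, 1, 0, 0, 0, 0, 0, 1, 0, 0],
    ![0, 1, 0, 1, 0, 0, 0, 0, 0, 0, 1],
    ![0, 0, 1, 0, 1, 0, 0, 0, 0, 0, 0],
    ![0, 0, 0, 1, 0, 1, 0, 0, 0, 1, 0],
    ![0, 0, 0, 0, 1, 0, 2, 1, 0, 0, 0],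
    ![3, 0, 0, 0, 0, 2, 0, 0, 1, 1, 0],
    ![1, 0, 0, 0, 0, 1, 0, 0, 0, 0, 0],
    ![0, 1, 0, 0, 0, 0, 1, 0, 0, 0, 0],
    ![0, 0, 0, 0, 1, 0, 1, 0, 0, 0, 0],
    ![1, 0, 1, 0, 0, 0, 0, 0, 0, 0, 0]]

/-- Degrees between the blocks of a `2 q`-regular spanning subgraph of the blow-up with block
sizes `oddBlockSize q j`. -/
def oddBlockDegree (q j : ℕ) (b b' : Fin 11) : ℕ :=
  ![0, oddBlockSize q j b', q - j, q - 1] (oddBlockKind b b')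

/-- The `j` extra vertices in each of parts 6 and 0 are balanced by degree `q - j` between blocks 5,
6 and blocks 0, 1. For parity, block 3 has only `q - 1` vertices, so blocks 2 and 4 lack one
neighbour. The single vertices added to parts 1 and 5 restore it, and the neighbour they also give
to blocks 0 and 6 is removed by degree `q - 1` between these two. -/
theorem mul_le_rex_of_odd {q j : ℕ} (hq : 1 ≤ q) (hj : j ≤ q) {w : W} (c : F.Walk w w)
    (hc : Odd c.length) (hck : c.length < 7) :
    (7 * q + 2 * j + 1) * q ≤ rex (7 * q + 2 * j + 1) F := by
  have hsymm : ∀ b b', oddBlockKind b' b = oddBlockKind b b' := by decide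
  have hsize : ∀ b b', 2 ≤ oddBlockKind b b' → b = 0 ∨ b = 1 ∨ b = 5 ∨ b = 6 := by decide
  have hsize' : ∀ b b', 2 ≤ oddBlockKind b b' → oddBlockSize q j b = q := by
    intro b b' h
    rcases hsize b b' h with rfl | rfl | rfl | rfl <;> rfl
  have hpart : ∀ b b', oddBlockKind b b' ≠ 0 →
      oddBlockPart b' = oddBlockPart b + 1 ∨ oddBlockPart b = oddBlockPart b' + 1 := by decide
  have hcases : ∀ i : Fin 4, i = 0 ∨ i = 1 ∨ 2 ≤ i ∧ (i = 2 ∨ i = 3) := by decide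
  refine mul_le_rex_of_block (s := oddBlockSize q j) (D := oddBlockDegree q j)
    (π := oddBlockPart) ?_ ?_ ?_ ?_ ?_ ?_ c hc hck
  · have hdiag : ∀ b, oddBlockKind b b = 0 := by decide
    intro b
    simp [oddBlockDegree, hdiag]
  · intro b b'
    simp only [oddBlockDegree, hsymm b b']
    rcases hcases (oddBlockKind b b') with h | h | ⟨h2, h⟩
    · simp [h]
    · simp [h]
    · right; right
      rw [hsize' b b' h2, hsize' b' b (by rwa [hsymm])]
      refine ⟨rfl, ?_⟩
      rcases h with h | h <;> simp [h]
  · intro b b'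
    simp only [oddBlockDegree]
    rcases hcases (oddBlockKind b b') with h | h | ⟨h2, h⟩
    · simp [h]
    · simp [h]
    · rw [hsize' b' b (by rwa [hsymm])]
      rcases h with h | h <;> simp [h]
  · intro b
    fin_cases b <;>
      simp [Fin.sum_univ_succ, oddBlockDegree, oddBlockKind, oddBlockSize] <;> omega
  · simp [Fin.sum_univ_succ, oddBlockSize]
    omega
  · intro b b' h
    refine hpart b b' fun h0 => h ?_
    simp [oddBlockDegree, h0]

end Constructions

/-! ### Lower and upper bounds for `rex`. -/

section Bounds

variable {W : Type*} {F : SimpleGraph W}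

theorem exists_le_rex_of_odd_walk {w : W} (c : F.Walk w w) (hc : Odd c.length) :
    ∃ C : ℝ, ∀ n : ℕ, Odd n →
      (n : ℝ) ^ 2 / ((c.length : ℝ) + 2) - C * (n : ℝ) ≤ (rex n F : ℝ) := by
  obtain ⟨k, hk⟩ : ∃ k, k = c.length + 2 := ⟨_, rfl⟩
  have hkR : (c.length : ℝ) + 2 = k := by rw [hk]; push_cast; ring
  have hk3 : 3 ≤ k := by obtain ⟨m, hm⟩ := hc; omega
  have hkodd : k % 2 = 1 := by obtain ⟨m, hm⟩ := hc; omega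
  have hkpos : (0 : ℝ) < k := by exact_mod_cast (by omega : 0 < k)
  refine ⟨k + 2, fun n _ => ?_⟩
  rw [hkR]
  have hn0 : (0 : ℝ) ≤ n := n.cast_nonneg
  have hrex0 : (0 : ℝ) ≤ rex n F := Nat.cast_nonneg _
  rw [sub_le_iff_le_add, div_le_iff₀ hkpos]
  -- Below this threshold the error term alone covers `n ^ 2 / k`; above it the construction has
  -- room for `j ≤ q`.
  by_cases hn : n < k * (k + 2)
  · have hn' : (n : ℝ) ≤ k * (k + 2) := by exact_mod_cast hn.le
    nlinarith [mul_nonneg hrex0 hkpos.le]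
  · obtain ⟨q, j, hj, hqj⟩ : ∃ q j, j < k ∧ n = k * q + 2 * j := by
      have hdm := Nat.div_add_mod n k
      have hlt := Nat.mod_lt n (by omega : k > 0)
      rcases Nat.even_or_odd' (n % k) with ⟨j, hj | hj⟩
      · exact ⟨n / k, j, by omega, by omega⟩
      · have hpos : 1 ≤ n / k := (Nat.one_le_div_iff (by omega)).2 (by nlinarith)
        refine ⟨n / k - 1, (n % k + k) / 2, by omega, ?_⟩
        obtain ⟨a, ha⟩ : ∃ a, n / k = a + 1 := ⟨n / k - 1, by omega⟩
        rw [ha] at hdm ⊢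
        rw [Nat.add_sub_cancel]
        rw [mul_add] at hdm
        omega
    have hjq : j ≤ q := by
      by_contra hlt
      have : k * q ≤ k * k := Nat.mul_le_mul_left k (by omega)
      nlinarith
    have h := mul_le_rex_of_even hk3 hjq c hc (by omega)
    rw [← hqj] at h
    have h' : (n : ℝ) * q ≤ rex n F := by exact_mod_cast h
    have hqj' : (n : ℝ) = k * q + 2 * j := by exact_mod_cast hqj
    have hj' : (j : ℝ) ≤ k := by exact_mod_cast hj.le
    calc (n : ℝ) ^ 2 = n * (k * q + 2 * j) := by rw [← hqj']; ring
      _ ≤ n * (k * q + 2 * k) := by gcongr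
      _ = (n * q + 2 * n) * k := by ring
      _ ≤ (rex n F + (k + 2) * n) * k := by
        gcongr
        linarith

theorem mul_div_seven_le_rex {w : W} (c : F.Walk w w) (hc : c.length = 5) {n : ℕ}
    (hn : 21 ≤ n) : n * (n / 7) ≤ rex n F := by
  have hodd : Odd c.length := hc ▸ by decide
  have hdm := Nat.div_add_mod n 7
  -- Here `j ≤ 3`, so `n ≥ 21` ensures `j ≤ n / 7`. In the odd case lowering `q` by one would cost
  -- `n` edges, hence the second construction.
  rcases Nat.even_or_odd' (n % 7) with ⟨j, hj | hj⟩
  · have h := mul_le_rex_of_even (k := 7) (q := n / 7) (j := j) (by omega) (by omega) c hodd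
      (by omega)
    rwa [show 7 * (n / 7) + 2 * j = n by omega] at h
  · have h := mul_le_rex_of_odd (q := n / 7) (j := j) (by omega) (by omega) c hodd (by omega)
    rwa [show 7 * (n / 7) + 2 * j + 1 = n by omega] at h

theorem rex_le_mul_div_seven [Finite W]
    (hF : Nonempty (F ≃g cycleGraph 5) ∨ IsUnicyclicWith F 5) {n : ℕ} (hodd : Odd n)
    (hn : 126 ≤ n) (hW : Nat.card W ≤ n / 7) : rex n F ≤ n * (n / 7) := by
  refine rex_le fun G _ d hd hfree => ?_
  by_contra hlt
  -- Evenness of `d` improves `d > 2 * (n / 7)` to `d ≥ 2 * (n / 7) + 2`, which gives `7 * d > 2 *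
  -- n`.
  have heven : Even (n * d) := by
    have hsum := G.sum_degrees_eq_twice_card_edges
    simp only [hd.degree_eq, Finset.sum_const, Finset.card_univ, Fintype.card_fin,
      smul_eq_mul] at hsum
    exact hsum ▸ even_two_mul _
  have hdeven : Even d := (Nat.even_mul.1 heven).resolve_left (Nat.not_even_iff_odd.2 hodd)
  obtain ⟨m, hm⟩ := hdeven
  have hpent : cycleGraph 5 ⊑ G := hd.cycleGraph_five_isContained
    (by rwa [Fintype.card_fin]) (by rwa [Fintype.card_fin]) (by rw [Fintype.card_fin]; omega)
  rcases hF with ⟨⟨e⟩⟩ | hF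
  · exact hfree (IsContained.trans ⟨e.toCopy⟩ hpent)
  · exact hfree (isContained_of_isUnicyclicWith_five hF (fun u => by rw [hd.degree_eq]; omega)
      hpent)

theorem exists_walk_length_five
    (hF : Nonempty (F ≃g cycleGraph 5) ∨ IsUnicyclicWith F 5) :
    ∃ (w : W) (c : F.Walk w w), c.length = 5 := by
  rcases hF with ⟨⟨e⟩⟩ | ⟨v, c, -, hlen, -⟩
  · have h : ∀ i : Fin 5, (cycleGraph 5).Adj i (i + 1) := by decide
    exact ⟨_, (Walk.cons (h 0) (Walk.cons (h 1) (Walk.cons (h 2) (Walk.cons (h 3)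
      (Walk.cons (h 4) Walk.nil))))).map e.symm.toHom, by simp⟩
  · exact ⟨v, c, hlen⟩

end Bounds

end SimpleGraph

theorem theorem3 {W : Type*} [Finite W] (F : SimpleGraph W) :
    (∀ g : ℕ, F.chromaticNumber = 3 → HasOddGirth F g →
      ∃ C : ℝ, ∀ n : ℕ, Odd n →
        (n : ℝ) ^ 2 / ((g : ℝ) + 2) - C * (n : ℝ) ≤ (rex n F : ℝ)) ∧
    (Nonempty (F ≃g SimpleGraph.cycleGraph 5) ∨ IsUnicyclicWith F 5 →
      (∃ C : ℝ, ∀ n : ℕ, Odd n →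
        (n : ℝ) ^ 2 / 7 - C * (n : ℝ) ≤ (rex n F : ℝ)) ∧
      (∃ N : ℕ, ∀ n : ℕ, N ≤ n → Odd n →
        (rex n F : ℝ) ≤ (n : ℝ) ^ 2 / 7) ∧
      (∃ N : ℕ, ∀ n : ℕ, N ≤ n → Odd n →
        rex n F = n * (n / 7))) := by
  refine ⟨?_, fun hF => ?_⟩
  · rintro g - ⟨⟨hodd, v, c, -, rfl⟩, -⟩
    exact SimpleGraph.exists_le_rex_of_odd_walk c hodd
  · obtain ⟨w, c, hc⟩ := SimpleGraph.exists_walk_length_five hF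
    -- The bound 126 is for finding a pentagon, and `7 * Nat.card W` makes the degree large enough
    -- for the greedy extension.
    have heq : ∀ n : ℕ, max 126 (7 * Nat.card W) ≤ n → Odd n → rex n F = n * (n / 7) := by
      intro n hn hodd
      rw [max_le_iff] at hn
      exact le_antisymm (SimpleGraph.rex_le_mul_div_seven hF hodd hn.1 (by omega))
        (SimpleGraph.mul_div_seven_le_rex c hc (by omega))
    refine ⟨?_, ⟨max 126 (7 * Nat.card W), fun n hn hodd => ?_⟩, _, heq⟩
    · obtain ⟨C, hC⟩ := SimpleGraph.exists_le_rex_of_odd_walk c (hc ▸ by decide)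
      refine ⟨C, fun n hn => ?_⟩
      have h := hC n hn
      rw [hc] at h
      norm_num at h
      linarith
    · rw [heq n hn hodd]
      have h : ((n / 7 : ℕ) : ℝ) ≤ (n : ℝ) / 7 := Nat.cast_div_le
      have hn0 : (0 : ℝ) ≤ n := n.cast_nonneg
      push_cast
      nlinarith
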